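/- Let $\mathcal F$ be a finite signature in which every symbol $f$ has an arity $\mathrm{ar}(f)$, partitioned into defined symbols $\mathcal D$ and constructors $\mathcal C$, and let $\mathcal V$ be a countably infinite set of variables. The depth of a term is $1$ for variables and $1+\max(\{0\}\cup\{\mathrm{depth}(t_i)\})$ for $f(t_1,\dots,t_n)$; its size is its number of occurrences of symbols and variables. Values are the terms built from variables and constructors; basic terms are variables and terms $f(v_1,\dots,v_n)$ with $f\in\mathcal D$ and all $v_i$ values. A constructor TRS is a set $\mathcal R$ of rules $l\to r$, where $l$ is not a variable, all variables of $r$ occur in $l$, and $l$ is basic. An innermost step is a rewrite step that contracts a redex all of whose arguments are normal forms. The innermost derivation height $\mathrm{dh}(s)$ is the maximal length of a sequence of innermost steps starting in $s$, and the innermost runtime complexity $\mathrm{rc}_{\mathcal R}(n)$ is the maximal length of such a sequence starting in a basic term of size at most $n$. A safe mapping assigns to each symbol $f$ a set of safe argument positions in $\{1,\dots,\mathrm{ar}(f)\}$; the other positions are normal, and all positions of constructors are safe. A precedence is a preorder $\succsim$ on $\mathcal F$, with strict part $\succ$ and equivalence $\sim$; it is admissible if $f\sim g$ implies that $f,g$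 are both defined or both constructors. Fix a safe mapping and a precedence. Safe equivalence $\approx$ is inductively defined: $s\approx t$ if $s=t$, or $s=f(s_1,\dots,s_n)$, $t=g(t_1,\dots,t_n)$, $f\sim g$ and there is a permutation $\pi$ such that for all $i$, $s_i\approx t_{\pi(i)}$, and $i$ is safe for $f$ iff $\pi(i)$ is safe for $g$. For $s=f(s_1,\dots,s_n)$ let $s\sqsupset t$ if 1. $s_i\sqsupset t$ or $s_i\approx t$ for some $i$, where $i$ is normal if $f\in\mathcal D$; or 2. $f\in\mathcal D$, $t=g(t_1,\dots,t_m)$, $f\succ g$ and $s\sqsupset t_j$ for all $j$. The polynomial path order $>_{\mathsf{pop*}}$ is inductively defined by $s=f(s_1,\dots,s_n)>_{\mathsf{pop*}}t$ if 1. $s_i>_{\mathsf{pop*}}t$ or $s_i\approx t$ for some $i$; or 2. $f\in\mathcal D$, $t=g(t_1,\dots,t_m)$, $f\succ g$, $s\sqsupset t_j$ for all normal positions $j$ of $g$, $s>_{\mathsf{pop*}}t_j$ for all safe positions $j$ of $g$, and for at most one safe position $j$ of $g$ the term $t_j$ contains a function symbol $h$ with $f\not\succ h$; or 3. $f\in\mathcal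 D$, $t=g(t_1,\dots,t_m)$, $f\sim g$, the multiset of normal arguments of $s$ is greater than that of $t$ in the strict multiset extension of $>_{\mathsf{pop*}}$ modulo $\approx$, and the multiset of safe arguments of $s$ is greater than or equal to that of $t$ in the corresponding weak multiset extension. A constructor TRS $\mathcal R$ is predicative recursive if there are a safe mapping and an admissible precedence such that $l>_{\mathsf{pop*}}r$ for all rules $l\to r$ in $\mathcal R$; we then say that $\mathcal R$ is compatible with them. **Theorem.** Let $\mathcal R$ be a finite predicative recursive constructor TRS over $\mathcal F$. Then there is a polynomial $p$, depending only on $\mathcal R$ and $\mathcal F$, such that for every safe mapping and every admissible precedence with which $\mathcal R$ is compatible, and for every basic term $s=f(v_1,\dots,v_n)$ with $f\in\mathcal D$, $$\mathrm{dh}(s)\le p\bigl(\max(\{0\}\cup\{\mathrm{depth}(v_i)\mid i \text{ a normal position of } f\})\bigr).$$ In particular, the innermost runtime complexity of $\mathcal R$ is polynomial: there is a polynomial $q$ with $\mathrm{rc}_{\mathcal R}(n)\le q(n)$ for all $n\in\mathbb N$. -/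

import Mathlib

namespace POP

universe u v

/-! ### Terms -/

/-- First-order terms over a signature, given by its type `F` of function symbols and the arity
function `ar`, with variables from `V`. -/
inductive Term {F : Type u} (ar : F → ℕ) (V : Type v) : Type (max u v)
  | var (x : V) : Term ar V
  | app (f : F) (ts : Fin (ar f) → Term ar V) : Term ar V

section

variable {F : Type u} {ar : F → ℕ} {V : Type v}

/-- The variables occurring in a term. -/
def Term.vars : Term ar V → Set V
  | .var x => {x}
  | .app _ ts => ⋃ i, (ts i).vars

/-- The number of occurrences of variables and function symbols. -/
def Term.size : Term ar V → ℕ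
  | .var _ => 1
  | .app _ ts => 1 + ∑ i, (ts i).size

/-- The depth: variables and constants have depth `1`. -/
def Term.depth : Term ar V → ℕ
  | .var _ => 1
  | .app _ ts => 1 + Finset.univ.sup fun i => (ts i).depth

/-- Application of a substitution. -/
def Term.subst (σ : V → Term ar V) : Term ar V → Term ar V
  | .var x => σ x
  | .app f ts => .app f fun i => (ts i).subst σ

/-- `TermsOver A t`: all function symbols of `t` belong to `A`. -/
inductive TermsOver (A : Set F) : Term ar V → Prop
  | var (x : V) : TermsOver A (.var x)
  | app (g : F) (ts : Fin (ar g) → Term ar V) (hg : g ∈ A) (hts : ∀ i, TermsOver A (ts i)) :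
      TermsOver A (.app g ts)

/-- Values are the terms built from variables and constructors. The set `D` is the set of defined
symbols; all other symbols are constructors. -/
def IsValue (D : Set F) (t : Term ar V) : Prop := TermsOver Dᶜ t

/-- Basic terms are variables and terms `f(v₁,…,vₙ)` with `f` defined and all `vᵢ` values. -/
def IsBasic (D : Set F) (t : Term ar V) : Prop :=
  (∃ x, t = .var x) ∨ ∃ f ∈ D, ∃ ts, t = .app f ts ∧ ∀ i, IsValue D (ts i)

/-! ### Rewriting -/

/-- A set of pairs of terms is a TRS if no left-hand side is a variable and all variables of a
right-hand side occur in the left-hand side. -/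
def IsTRS (R : Set (Term ar V × Term ar V)) : Prop :=
  ∀ l r, (l, r) ∈ R → (∀ x, l ≠ .var x) ∧ r.vars ⊆ l.vars

/-- Constructor TRSs: all left-hand sides are basic. -/
def IsConstructorTRS (D : Set F) (R : Set (Term ar V × Term ar V)) : Prop :=
  IsTRS R ∧ ∀ l r, (l, r) ∈ R → IsBasic D l

/-- The rewrite relation of `R`: the least relation containing `R` that is closed under
substitutions and contexts. -/
inductive Rew (R : Set (Term ar V × Term ar V)) : Term ar V → Term ar V → Prop
  | root (l r : Term ar V) (h : (l, r) ∈ R) (σ : V → Term ar V) : Rew R (l.subst σ) (r.subst σ)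
  | ctx (f : F) (ts : Fin (ar f) → Term ar V) (i : Fin (ar f)) (t : Term ar V)
      (h : Rew R (ts i) t) : Rew R (.app f ts) (.app f (Function.update ts i t))

/-- Normal forms with respect to the full rewrite relation. -/
def NF (R : Set (Term ar V × Term ar V)) (s : Term ar V) : Prop := ∀ t, ¬ Rew R s t

/-- The innermost rewrite relation: all arguments of the contracted redex are normal forms. -/
inductive IRew (R : Set (Term ar V × Term ar V)) : Term ar V → Term ar V → Prop
  | root (l r : Term ar V) (h : (l, r) ∈ R) (σ : V → Term ar V)
      (hnf : ∀ f ts, l.subst σ = .app f ts → ∀ i, NF R (ts i)) : IRew R (l.subst σ) (r.subst σ)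
  | ctx (f : F) (ts : Fin (ar f) → Term ar V) (i : Fin (ar f)) (t : Term ar V)
      (h : IRew R (ts i) t) : IRew R (.app f ts) (.app f (Function.update ts i t))

/-- The `n`-fold composition of a relation. -/
def relPow {α : Type*} (r : α → α → Prop) : ℕ → α → α → Prop
  | 0 => Eq
  | n + 1 => Relation.Comp r (relPow r n)

/-- The innermost derivation height of `s`: the supremum of the lengths of innermost derivations
starting in `s`, taken in `ℕ∞` (so it is `⊤` if the lengths are unbounded). -/
noncomputable def dheight (R : Set (Term ar V × Term ar V)) (s : Term ar V) : ℕ∞ :=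
  ⨆ (ℓ : ℕ) (_ : ∃ t, relPow (IRew R) ℓ s t), (ℓ : ℕ∞)

/-- The innermost runtime complexity function: the supremum of the lengths of innermost
derivations starting in basic terms of size at most `n`, taken in `ℕ∞`. -/
noncomputable def runtimeComplexity (D : Set F) (R : Set (Term ar V × Term ar V)) (n : ℕ) : ℕ∞ :=
  ⨆ (s : Term ar V) (_ : IsBasic D s ∧ s.size ≤ n), dheight R s

/-! ### Safe mappings and precedences -/

/-- A safe mapping assigns to every function symbol its set of safe argument positions (the other
positions are normal); all argument positions of constructors are safe. -/
structure SafeMapping {F : Type u} (ar : F → ℕ) (D : Set F) where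
  /-- The safe argument positions. -/
  safe : (f : F) → Finset (Fin (ar f))
  safe_of_constructor : ∀ f ∉ D, safe f = Finset.univ

/-- The multiset of arguments at safe positions. -/
def SafeMapping.safeArgs {D : Set F} (S : SafeMapping ar D) (f : F)
    (ts : Fin (ar f) → Term ar V) : Multiset (Term ar V) :=
  (S.safe f).val.map ts

/-- The multiset of arguments at normal positions. -/
def SafeMapping.normalArgs {D : Set F} (S : SafeMapping ar D) (f : F)
    (ts : Fin (ar f) → Term ar V) : Multiset (Term ar V) :=
  ((S.safe f)ᶜ).val.map ts

/-- The maximal depth of the arguments at normal positions (`0` if there are none). -/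
def SafeMapping.normalDepth {D : Set F} (S : SafeMapping ar D) (f : F)
    (ts : Fin (ar f) → Term ar V) : ℕ :=
  ((S.safe f)ᶜ).sup fun i => (ts i).depth

/-- `f ≻ g` in the precedence `P`: `f ≿ g` but not `g ≿ f`. -/
def PrecGt (P : Preorder F) (f g : F) : Prop := P.le g f ∧ ¬ P.le f g

/-- `f ∼ g` in the precedence `P`: `f ≿ g` and `g ≿ f`. -/
def PrecEquiv (P : Preorder F) (f g : F) : Prop := P.le g f ∧ P.le f g

/-- A precedence is admissible if equivalent symbols are both defined or both constructors. -/
def Admissible (D : Set F) (P : Preorder F) : Prop :=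
  ∀ f g, PrecEquiv P f g → (f ∈ D ↔ g ∈ D)

/-! ### Multiset extensions -/

/-- The strict multiset extension of `gt` modulo the equivalence `eqv`: up to `eqv`, the multiset
`N` arises from `M` by replacing a nonempty submultiset `X` by a multiset `Y` all of whose elements
are dominated by elements of `X`. (For `eqv` compatible with `gt`, this is the multiset extension
of the relation that `gt` induces on equivalence classes.) -/
def MulGt {α : Type*} (eqv gt : α → α → Prop) (M N : Multiset α) : Prop :=
  ∃ X Y Z Z' : Multiset α, M = Z + X ∧ N = Z' + Y ∧ X ≠ 0 ∧ Multiset.Rel eqv Z Z' ∧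
    ∀ y ∈ Y, ∃ x ∈ X, gt x y

/-- The weak multiset extension. -/
def MulGe {α : Type*} (eqv gt : α → α → Prop) (M N : Multiset α) : Prop :=
  MulGt eqv gt M N ∨ Multiset.Rel eqv M N

theorem MulGt.mono {α : Type*} {eqv gt gt' : α → α → Prop} (h : ∀ a b, gt a b → gt' a b)
    {M N : Multiset α} (hM : MulGt eqv gt M N) : MulGt eqv gt' M N := by
  obtain ⟨X, Y, Z, Z', h1, h2, h3, h4, h5⟩ := hM
  refine ⟨X, Y, Z, Z', h1, h2, h3, h4, fun y hy => ?_⟩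
  obtain ⟨x, hx, hxy⟩ := h5 y hy
  exact ⟨x, hx, h _ _ hxy⟩

theorem MulGe.mono {α : Type*} {eqv gt gt' : α → α → Prop} (h : ∀ a b, gt a b → gt' a b)
    {M N : Multiset α} (hM : MulGe eqv gt M N) : MulGe eqv gt' M N :=
  hM.imp (MulGt.mono h) id

/-! ### The polynomial path order -/

variable {D : Set F}

/-- Safe equivalence of terms. -/
inductive SafeEquiv (S : SafeMapping ar D) (P : Preorder F) : Term ar V → Term ar V → Prop
  | refl (t : Term ar V) : SafeEquiv S P t t
  | app (f g : F) (ss : Fin (ar f) → Term ar V) (ts : Fin (ar g) → Term ar V)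
      (hfg : PrecEquiv P f g) (π : Fin (ar f) ≃ Fin (ar g))
      (h : ∀ i, SafeEquiv S P (ss i) (ts (π i)))
      (hsafe : ∀ i, i ∈ S.safe f ↔ π i ∈ S.safe g) :
      SafeEquiv S P (.app f ss) (.app g ts)

/-- The auxiliary order. The clause `sᵢ ⊒ t` is split into the two cases of `⊒`. -/
inductive Gsq (S : SafeMapping ar D) (P : Preorder F) : Term ar V → Term ar V → Prop
  | st_equiv (f : F) (ss : Fin (ar f) → Term ar V) (t : Term ar V) (i : Fin (ar f))
      (hi : f ∈ D → i ∉ S.safe f) (h : SafeEquiv S P (ss i) t) : Gsq S P (.app f ss) t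
  | st_gt (f : F) (ss : Fin (ar f) → Term ar V) (t : Term ar V) (i : Fin (ar f))
      (hi : f ∈ D → i ∉ S.safe f) (h : Gsq S P (ss i) t) : Gsq S P (.app f ss) t
  | ia (f g : F) (ss : Fin (ar f) → Term ar V) (ts : Fin (ar g) → Term ar V)
      (hf : f ∈ D) (hfg : PrecGt P f g) (h : ∀ j, Gsq S P (.app f ss) (ts j)) :
      Gsq S P (.app f ss) (.app g ts)

/-- The polynomial path order. The clause `sᵢ ≥ t` is split into its two cases. In the last clause
the order is used inside multiset extensions; as these are monotone, this is expressed through a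
subrelation `gt` of the order (see `gpop_iff` for the resulting characterisation). -/
inductive Gpop (S : SafeMapping ar D) (P : Preorder F) : Term ar V → Term ar V → Prop
  | st_equiv (f : F) (ss : Fin (ar f) → Term ar V) (t : Term ar V) (i : Fin (ar f))
      (h : SafeEquiv S P (ss i) t) : Gpop S P (.app f ss) t
  | st_gt (f : F) (ss : Fin (ar f) → Term ar V) (t : Term ar V) (i : Fin (ar f))
      (h : Gpop S P (ss i) t) : Gpop S P (.app f ss) t
  | ia (f g : F) (ss : Fin (ar f) → Term ar V) (ts : Fin (ar g) → Term ar V)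
      (hf : f ∈ D) (hfg : PrecGt P f g)
      (hnormal : ∀ j, j ∉ S.safe g → Gsq S P (.app f ss) (ts j))
      (hsafe : ∀ j, j ∈ S.safe g → Gpop S P (.app f ss) (ts j))
      (hone : ∀ j j', j ∈ S.safe g → j' ∈ S.safe g →
        ¬ TermsOver {h | PrecGt P f h} (ts j) → ¬ TermsOver {h | PrecGt P f h} (ts j') → j = j') :
      Gpop S P (.app f ss) (.app g ts)
  | ep (f g : F) (ss : Fin (ar f) → Term ar V) (ts : Fin (ar g) → Term ar V)
      (hf : f ∈ D) (hfg : PrecEquiv P f g)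
      (gt : Term ar V → Term ar V → Prop) (hgt : ∀ a b, gt a b → Gpop S P a b)
      (hnormal : MulGt (SafeEquiv S P) gt (S.normalArgs f ss) (S.normalArgs g ts))
      (hsafe : MulGe (SafeEquiv S P) gt (S.safeArgs f ss) (S.safeArgs g ts)) :
      Gpop S P (.app f ss) (.app g ts)

/-- The defining clauses of the polynomial path order. -/
theorem gpop_iff (S : SafeMapping ar D) (P : Preorder F) (f : F) (ss : Fin (ar f) → Term ar V)
    (t : Term ar V) :
    Gpop S P (.app f ss) t ↔
      (∃ i, Gpop S P (ss i) t ∨ SafeEquiv S P (ss i) t) ∨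
      (f ∈ D ∧ ∃ g ts, t = .app g ts ∧ PrecGt P f g ∧
        (∀ j, j ∉ S.safe g → Gsq S P (.app f ss) (ts j)) ∧
        (∀ j, j ∈ S.safe g → Gpop S P (.app f ss) (ts j)) ∧
        (∀ j j', j ∈ S.safe g → j' ∈ S.safe g → ¬ TermsOver {h | PrecGt P f h} (ts j) →
          ¬ TermsOver {h | PrecGt P f h} (ts j') → j = j')) ∨
      (f ∈ D ∧ ∃ g ts, t = .app g ts ∧ PrecEquiv P f g ∧
        MulGt (SafeEquiv S P) (Gpop S P) (S.normalArgs f ss) (S.normalArgs g ts) ∧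
        MulGe (SafeEquiv S P) (Gpop S P) (S.safeArgs f ss) (S.safeArgs g ts)) := by
  constructor
  · intro h
    cases h with
    | st_equiv _ _ _ i h => exact Or.inl ⟨i, Or.inr h⟩
    | st_gt _ _ _ i h => exact Or.inl ⟨i, Or.inl h⟩
    | ia _ g _ ts hf hfg h1 h2 h3 => exact Or.inr (Or.inl ⟨hf, g, ts, rfl, hfg, h1, h2, h3⟩)
    | ep _ g _ ts hf hfg gt hgt h1 h2 =>
      exact Or.inr (Or.inr ⟨hf, g, ts, rfl, hfg, h1.mono hgt, h2.mono hgt⟩)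
  · rintro (⟨i, h | h⟩ | ⟨hf, g, ts, rfl, hfg, h1, h2, h3⟩ | ⟨hf, g, ts, rfl, hfg, h1, h2⟩)
    · exact .st_gt _ _ _ i h
    · exact .st_equiv _ _ _ i h
    · exact .ia _ _ _ _ hf hfg h1 h2 h3
    · exact .ep _ _ _ _ hf hfg _ (fun _ _ h => h) h1 h2

/-- `R` is compatible with the polynomial path order induced by `S` and `P`. -/
def Compatible (S : SafeMapping ar D) (P : Preorder F) (R : Set (Term ar V × Term ar V)) : Prop :=
  ∀ l r, (l, r) ∈ R → Gpop S P l r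

/-- Predicative recursive TRSs: constructor TRSs compatible with some polynomial path order that
is based on an admissible precedence. -/
def PredicativeRecursive (D : Set F) (R : Set (Term ar V × Term ar V)) : Prop :=
  IsConstructorTRS D R ∧
    ∃ (S : SafeMapping ar D) (P : Preorder F), Admissible D P ∧ Compatible S P R

end

end POP

namespace POP

universe u v

/-! By well-founded induction on the precedence, every symbol `f` satisfies `CallBound`: on
normal-form arguments, the number of steps is polynomial in the depth of the normal arguments alone,
and the result is deeper than the safe arguments by at most such a polynomial. Because safe depth
enters only additively, results may pass through safe positions repeatedly without the polynomials
composing.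

For a rule `l → r`, every call in `r` is either to a smaller symbol or to one equivalent to `f`.
Since at most one safe argument may contain symbols not below `f`, the latter is reached at most
once. So if a recursive call costs `a` steps and adds depth `b`, then `r` costs `a + poly` and adds
`b + poly`, with coefficient one on `a` and `b` (`Gpop.exists_costBound`).

Each recursive call strictly decreases the multiset of depths of normal arguments. Reading the
largest depths as digits to base `d + 1` bounds the length of such a chain by `(d + 1) ^ k`
(`multisetRank_lt_of_mulGt`), so the additive overheads sum to a polynomial (`exists_callBound`). A
finite signature has finitely many safe mappings and precedences, so summing the polynomials makes
the bound independent of them. -/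

theorem eval_mono (p : Polynomial ℕ) {m n : ℕ} (h : m ≤ n) : p.eval m ≤ p.eval n := by
  rw [Polynomial.eval_eq_sum_range, Polynomial.eval_eq_sum_range]
  exact Finset.sum_le_sum fun i _ => Nat.mul_le_mul_left _ (Nat.pow_le_pow_left h i)

theorem eval_le_eval_sum {ι : Type*} (s : Finset ι) (p : ι → Polynomial ℕ) (n : ℕ) {i : ι}
    (hi : i ∈ s) : (p i).eval n ≤ (∑ j ∈ s, p j).eval n := by
  rw [Polynomial.eval_finsetSum]
  exact Finset.single_le_sum (f := fun j => (p j).eval n) (fun _ _ => Nat.zero_le _) hi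

/-! ### A polynomial rank for multisets of natural numbers -/

/-- The number whose digits to base `B` are the `k` largest elements of `M`, in descending
order. -/
def multisetRank (B : ℕ) : ℕ → Multiset ℕ → ℕ
  | 0, _ => 0
  | k + 1, M => M.sup * B ^ k + multisetRank B k (M.erase M.sup)

theorem multisetRank_lt {B : ℕ} (hB : 0 < B) (k : ℕ) :
    ∀ M : Multiset ℕ, (∀ m ∈ M, m < B) → multisetRank B k M < B ^ k := by
  induction k with
  | zero => intro M _; simp [multisetRank]
  | succ k ih =>
    intro M hM
    have h1 := ih (M.erase M.sup) fun m hm => hM m (Multiset.mem_of_mem_erase hm)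
    have h2 : M.sup < B := by
      refine (Nat.lt_succ_of_le (Multiset.sup_le (a := B - 1) |>.2 fun b hb => ?_)).trans_le ?_
      · have := hM b hb
        omega
      · omega
    calc multisetRank B (k + 1) M < M.sup * B ^ k + B ^ k := Nat.add_lt_add_left h1 _
      _ = (M.sup + 1) * B ^ k := by ring
      _ ≤ B * B ^ k := Nat.mul_le_mul_right _ h2
      _ = B ^ (k + 1) := by ring

theorem sup_mem_of_pos {M : Multiset ℕ} (h : 0 < M.sup) : M.sup ∈ M := by
  induction M using Multiset.induction with
  | empty => simp at h
  | cons a M ih =>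
    rw [Multiset.sup_cons] at h ⊢
    rcases le_total M.sup a with h' | h'
    · simp [h']
    · rw [sup_eq_right.2 h'] at h ⊢
      exact Multiset.mem_cons_of_mem (ih h)

theorem MulGt.exists_le {M N : Multiset ℕ} (h : MulGt Eq (· > ·) M N) {n : ℕ} (hn : n ∈ N) :
    ∃ m ∈ M, n ≤ m := by
  obtain ⟨X, Y, Z, Z', rfl, rfl, -, hZ, hY⟩ := h
  rw [Multiset.rel_eq] at hZ
  subst hZ
  rcases Multiset.mem_add.1 hn with hn | hn
  · exact ⟨n, Multiset.mem_add.2 (.inl hn), le_rfl⟩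
  · obtain ⟨x, hx, hxn⟩ := hY n hn
    exact ⟨x, Multiset.mem_add.2 (.inr hx), hxn.le⟩

/-- If the maxima agree, the maximum of `N` cannot be dominated by an element of `M`, so it lies in
the common part and can be erased from both sides; otherwise the leading digit decides. Only `M`
needs at most `k` elements: `N` may be larger, its excess being truncated. Positivity ensures that
the maximum of `M` is an actual element and not the default `0`. -/
theorem multisetRank_lt_of_mulGt {B : ℕ} (k : ℕ) :
    ∀ M N : Multiset ℕ, (∀ m ∈ M, 0 < m ∧ m < B) → M.card ≤ k → MulGt Eq (· > ·) M N →
      multisetRank B k N < multisetRank B k M := by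
  induction k with
  | zero =>
    rintro M N - hc ⟨X, Y, Z, Z', rfl, -, hX, -⟩
    simp at hc
    exact absurd hc.2 hX
  | succ k ih =>
    intro M N hM hc h
    have hsup : N.sup ≤ M.sup := Multiset.sup_le.2 fun n hn => by
      obtain ⟨m, hm, hnm⟩ := h.exists_le hn
      exact hnm.trans (Multiset.le_sup hm)
    have hM0 : 0 < M.sup := by
      obtain ⟨X, Y, Z, Z', hMX, -, hX, -⟩ := h
      obtain ⟨x, hx⟩ := Multiset.exists_mem_of_ne_zero hX
      have hxM : x ∈ M := hMX ▸ Multiset.mem_add.2 (.inr hx)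
      exact (hM x hxM).1.trans_le (Multiset.le_sup hxM)
    have hMm := sup_mem_of_pos hM0
    have hB : 0 < B := (hM _ hMm).1.trans (hM _ hMm).2
    rcases hsup.lt_or_eq with hlt | heq
    · have h1 : multisetRank B k (N.erase N.sup) < B ^ k := by
        refine multisetRank_lt hB k _ fun n hn => ?_
        obtain ⟨m, hm, hnm⟩ := h.exists_le (Multiset.mem_of_mem_erase hn)
        exact hnm.trans_lt (hM m hm).2
      calc multisetRank B (k + 1) N < N.sup * B ^ k + B ^ k := Nat.add_lt_add_left h1 _
        _ = (N.sup + 1) * B ^ k := by ring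
        _ ≤ M.sup * B ^ k := Nat.mul_le_mul_right _ hlt
        _ ≤ multisetRank B (k + 1) M := Nat.le_add_right _ _
    · simp only [multisetRank, heq]
      refine Nat.add_lt_add_left (ih _ _ (fun m hm => hM m (Multiset.mem_of_mem_erase hm)) ?_ ?_) _
      · rw [Multiset.card_erase_of_mem hMm]
        exact Nat.pred_le_iff.2 hc
      · have hNm : M.sup ∈ N := heq ▸ sup_mem_of_pos (heq ▸ hM0)
        obtain ⟨X, Y, Z, Z', hMX, rfl, hX, hZ, hY⟩ := h
        rw [Multiset.rel_eq] at hZ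
        subst hZ
        have hmZ : M.sup ∈ Z := by
          rcases Multiset.mem_add.1 hNm with h | h
          · exact h
          · obtain ⟨x, hx, hlt⟩ := hY _ h
            have : x ≤ M.sup := Multiset.le_sup (hMX ▸ Multiset.mem_add.2 (.inr hx))
            exact absurd hlt (not_lt.2 this)
        refine ⟨X, Y, Z.erase M.sup, Z.erase M.sup, ?_, ?_, hX, Multiset.rel_eq.2 rfl, hY⟩
        · rw [← Multiset.erase_add_left_pos X hmZ, ← hMX]
        · rw [← Multiset.erase_add_left_pos Y hmZ]

theorem MulGe.exists_of_mem {α : Type*} {eqv gt : α → α → Prop} {M N : Multiset α}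
    (h : MulGe eqv gt M N) {n : α} (hn : n ∈ N) : ∃ m ∈ M, eqv m n ∨ gt m n := by
  have key : ∀ {Z Z' : Multiset α}, Multiset.Rel eqv Z Z' → n ∈ Z' → ∃ m ∈ Z, eqv m n := by
    intro Z Z' hZ hn
    obtain ⟨m, hm, h⟩ := Multiset.exists_mem_of_rel_of_mem (Multiset.rel_flip.2 hZ) hn
    exact ⟨m, hm, h⟩
  rcases h with ⟨X, Y, Z, Z', rfl, rfl, -, hZ, hY⟩ | h
  · rcases Multiset.mem_add.1 hn with hn | hn
    · obtain ⟨m, hm, h⟩ := key hZ hn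
      exact ⟨m, Multiset.mem_add.2 (.inl hm), .inl h⟩
    · obtain ⟨x, hx, h⟩ := hY n hn
      exact ⟨x, Multiset.mem_add.2 (.inr hx), .inr h⟩
  · obtain ⟨m, hm, h⟩ := key h hn
    exact ⟨m, hm, .inl h⟩

theorem MulGt.map {α β : Type*} {eqv gt : α → α → Prop} {eqv' gt' : β → β → Prop} {φ : α → β}
    {M N : Multiset α} (h : MulGt eqv gt M N) (he : ∀ a ∈ M, ∀ b, eqv a b → eqv' (φ a) (φ b))
    (hg : ∀ a ∈ M, ∀ b, gt a b → gt' (φ a) (φ b)) : MulGt eqv' gt' (M.map φ) (N.map φ) := by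
  obtain ⟨X, Y, Z, Z', rfl, rfl, hX, hZ, hY⟩ := h
  refine ⟨X.map φ, Y.map φ, Z.map φ, Z'.map φ, Multiset.map_add .., Multiset.map_add .., ?_, ?_, ?_⟩
  · simpa using hX
  · rw [Multiset.rel_map]
    exact hZ.mono fun a ha b _ h => he a (Multiset.mem_add.2 (.inl ha)) b h
  · intro y hy
    obtain ⟨b, hb, rfl⟩ := Multiset.mem_map.1 hy
    obtain ⟨x, hx, hxb⟩ := hY b hb
    exact ⟨φ x, Multiset.mem_map_of_mem φ hx, hg x (Multiset.mem_add.2 (.inr hx)) b hxb⟩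

section

variable {F : Type u} {ar : F → ℕ} {V : Type v} {D : Set F} {R : Set (Term ar V × Term ar V)}

/-! ### Normal forms -/

theorem IRew.rew {s t : Term ar V} (h : IRew R s t) : Rew R s t := by
  induction h with
  | root l r h σ _ => exact .root l r h σ
  | ctx f ts i t _ ih => exact .ctx f ts i t ih

theorem NF.arg {f : F} {ts : Fin (ar f) → Term ar V} (h : NF R (.app f ts)) (i : Fin (ar f)) :
    NF R (ts i) := fun t ht => h _ (.ctx f ts i t ht)

theorem NF.of_mem_vars {σ : V → Term ar V} {t : Term ar V} (h : NF R (t.subst σ)) {x : V}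
    (hx : x ∈ t.vars) : NF R (σ x) := by
  induction t with
  | var y =>
    obtain rfl : x = y := hx
    exact h
  | app f ts ih =>
    obtain ⟨i, hi⟩ := Set.mem_iUnion.1 hx
    exact ih i (NF.arg h i) hi

theorem Term.subst_congr {σ τ : V → Term ar V} {t : Term ar V} (h : ∀ x ∈ t.vars, σ x = τ x) :
    t.subst σ = t.subst τ := by
  induction t with
  | var x => exact h x rfl
  | app f ts ih =>
    simp only [Term.subst]
    congr 1
    funext i
    exact ih i fun x hx => h x (Set.mem_iUnion.2 ⟨i, hx⟩)

theorem IsConstructorTRS.exists_eq_app (hR : IsConstructorTRS D R) {l r : Term ar V}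
    (h : (l, r) ∈ R) : ∃ f ∈ D, ∃ ss, l = .app f ss ∧ ∀ i, IsValue D (ss i) := by
  rcases hR.2 l r h with ⟨x, hx⟩ | h'
  · exact absurd hx ((hR.1 l r h).1 x)
  · exact h'

theorem IsConstructorTRS.nf_var (hR : IsConstructorTRS D R) (x : V) : NF R (.var x) := by
  intro t ht
  generalize hs : Term.var x = s at ht
  cases ht with
  | root l r h σ =>
    obtain ⟨f, _, ss, rfl, _⟩ := hR.exists_eq_app h
    cases hs
  | ctx => cases hs

theorem IsConstructorTRS.nf_app (hR : IsConstructorTRS D R) {f : F} (hf : f ∉ D)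
    {ts : Fin (ar f) → Term ar V} (hts : ∀ i, NF R (ts i)) : NF R (.app f ts) := by
  intro t ht
  generalize hs : Term.app f ts = s at ht
  cases ht with
  | root l r h σ =>
    obtain ⟨g, hg, ss, rfl, _⟩ := hR.exists_eq_app h
    simp only [Term.subst] at hs
    cases hs
    exact hf hg
  | ctx g us i u h =>
    cases hs
    exact hts i _ h

theorem IsConstructorTRS.nf_subst (hR : IsConstructorTRS D R) {σ : V → Term ar V}
    (hσ : ∀ x, NF R (σ x)) {t : Term ar V} (ht : IsValue D t) : NF R (t.subst σ) := by
  induction ht with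
  | var x => exact hσ x
  | app g ts hg _ ih => exact hR.nf_app hg ih

theorem IsValue.nf (hR : IsConstructorTRS D R) {t : Term ar V} (ht : IsValue D t) : NF R t := by
  induction ht with
  | var x => exact hR.nf_var x
  | app g ts hg _ ih => exact hR.nf_app hg ih

theorem IsValue.arg {f : F} {ts : Fin (ar f) → Term ar V} (h : IsValue D (.app f ts)) :
    f ∉ D ∧ ∀ i, IsValue D (ts i) := by
  generalize hs : Term.app f ts = s at h
  cases h with
  | var x => cases hs
  | app g us hg hus =>
    cases hs
    exact ⟨hg, hus⟩

/-! ### The order on values -/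

theorem Term.depth_pos (t : Term ar V) : 0 < t.depth := by
  cases t <;> simp [Term.depth]

theorem Term.depth_arg_lt (f : F) (ts : Fin (ar f) → Term ar V) (i : Fin (ar f)) :
    (ts i).depth < (Term.app f ts).depth := by
  have : (ts i).depth ≤ Finset.univ.sup fun i => (ts i).depth :=
    Finset.le_sup (f := fun i => (ts i).depth) (Finset.mem_univ i)
  simp only [Term.depth]
  omega

theorem Term.depth_le_size (t : Term ar V) : t.depth ≤ t.size := by
  induction t with
  | var x => simp [Term.depth, Term.size]
  | app f ts ih =>
    simp only [Term.depth, Term.size]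
    refine Nat.add_le_add_left (Finset.sup_le fun i _ => (ih i).trans ?_) 1
    exact Finset.single_le_sum (f := fun i => (ts i).size) (fun _ _ => Nat.zero_le _)
      (Finset.mem_univ i)

variable {S : SafeMapping ar D} {P : Preorder F}

/-- Depth is a maximum over arguments, hence blind to permutations and to the names of symbols. -/
theorem SafeEquiv.depth_subst_eq {s t : Term ar V} (h : SafeEquiv S P s t) (σ : V → Term ar V) :
    (s.subst σ).depth = (t.subst σ).depth := by
  induction h with
  | refl => rfl
  | app f g ss ts _ π _ _ ih =>
    simp only [Term.subst, Term.depth, ih]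
    congr 1
    apply le_antisymm
    · exact Finset.sup_le fun i _ =>
        Finset.le_sup (f := fun j => ((ts j).subst σ).depth) (Finset.mem_univ (π i))
    · refine Finset.sup_le fun j _ => ?_
      have := Finset.le_sup (f := fun i => ((ts (π i)).subst σ).depth) (Finset.mem_univ (π.symm j))
      simpa using this

theorem SafeEquiv.isValue (hP : Admissible D P) {s t : Term ar V} (h : SafeEquiv S P s t)
    (hs : IsValue D s) : IsValue D t := by
  induction h with
  | refl => exact hs
  | app f g ss ts hfg π _ _ ih =>
    obtain ⟨hf, hss⟩ := hs.arg
    refine .app g ts (fun hg => hf ((hP f g hfg).2 hg)) fun j => ?_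
    have := ih (π.symm j) (hss _)
    rwa [π.apply_symm_apply] at this

/-- A value has a constructor at its root, so only the subterm clauses can apply. The same reason
gives the version for `Gpop`. Depths are compared after substitution because rules are used on
instances. -/
theorem Gsq.of_isValue (hP : Admissible D P) {s t : Term ar V} (h : Gsq S P s t)
    (hs : IsValue D s) :
    IsValue D t ∧ ∀ σ : V → Term ar V, (t.subst σ).depth < (s.subst σ).depth := by
  induction h with
  | st_equiv f ss t i _ h =>
    refine ⟨h.isValue hP (hs.arg.2 i), fun σ => ?_⟩
    rw [← h.depth_subst_eq σ]
    exact Term.depth_arg_lt f (fun i => (ss i).subst σ) i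
  | st_gt f ss t i _ _ ih =>
    obtain ⟨h1, h2⟩ := ih (hs.arg.2 i)
    exact ⟨h1, fun σ => (h2 σ).trans (Term.depth_arg_lt f (fun i => (ss i).subst σ) i)⟩
  | ia f g ss ts hf => exact absurd hf hs.arg.1

theorem Gpop.of_isValue (hP : Admissible D P) {s t : Term ar V} (h : Gpop S P s t)
    (hs : IsValue D s) :
    IsValue D t ∧ ∀ σ : V → Term ar V, (t.subst σ).depth < (s.subst σ).depth := by
  induction h with
  | st_equiv f ss t i h =>
    refine ⟨h.isValue hP (hs.arg.2 i), fun σ => ?_⟩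
    rw [← h.depth_subst_eq σ]
    exact Term.depth_arg_lt f (fun i => (ss i).subst σ) i
  | st_gt f ss t i _ ih =>
    obtain ⟨h1, h2⟩ := ih (hs.arg.2 i)
    exact ⟨h1, fun σ => (h2 σ).trans (Term.depth_arg_lt f (fun i => (ss i).subst σ) i)⟩
  | ia f g ss ts hf => exact absurd hf hs.arg.1
  | ep f g ss ts hf => exact absurd hf hs.arg.1

/-- The maximal depth of the arguments at safe positions (`0` if there are none). -/
def SafeMapping.safeDepth (S : SafeMapping ar D) (f : F) (ts : Fin (ar f) → Term ar V) : ℕ :=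
  (S.safe f).sup fun i => (ts i).depth

theorem SafeMapping.depth_le_normalDepth {f : F} {ts : Fin (ar f) → Term ar V} {i : Fin (ar f)}
    (hi : i ∉ S.safe f) : (ts i).depth ≤ S.normalDepth f ts :=
  Finset.le_sup (f := fun i => (ts i).depth) (Finset.mem_compl.2 hi)

theorem SafeMapping.depth_le_safeDepth {f : F} {ts : Fin (ar f) → Term ar V} {i : Fin (ar f)}
    (hi : i ∈ S.safe f) : (ts i).depth ≤ S.safeDepth f ts :=
  Finset.le_sup (f := fun i => (ts i).depth) hi

theorem SafeMapping.depth_arg_le (S : SafeMapping ar D) (f : F) (ts : Fin (ar f) → Term ar V)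
    (i : Fin (ar f)) : (ts i).depth ≤ S.normalDepth f ts + S.safeDepth f ts := by
  by_cases hi : i ∈ S.safe f
  · exact (S.depth_le_safeDepth hi).trans (Nat.le_add_left _ _)
  · exact (S.depth_le_normalDepth hi).trans (Nat.le_add_right _ _)

theorem SafeMapping.depth_app_le (S : SafeMapping ar D) (f : F) (ts : Fin (ar f) → Term ar V) :
    (Term.app f ts).depth ≤ 1 + (S.normalDepth f ts + S.safeDepth f ts) :=
  Nat.add_le_add_left (Finset.sup_le fun i _ => S.depth_arg_le f ts i) 1

/-! ### Simultaneous bounds on derivation lengths and depths of normal forms -/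

/-- All innermost derivations from `s` have length at most `n`, and the normal forms reached have
depth at most `d`. -/
def CostBound (R : Set (Term ar V × Term ar V)) (s : Term ar V) (n d : ℕ) : Prop :=
  ∀ ℓ t, relPow (IRew R) ℓ s t → ℓ ≤ n ∧ (NF R t → t.depth ≤ d)

theorem CostBound.mono {s : Term ar V} {n n' d d' : ℕ} (h : CostBound R s n d) (hn : n ≤ n')
    (hd : d ≤ d') : CostBound R s n' d' := fun ℓ t ht =>
  ⟨(h ℓ t ht).1.trans hn, fun hnf => ((h ℓ t ht).2 hnf).trans hd⟩

theorem CostBound.of_nf {s : Term ar V} (h : NF R s) {d : ℕ} (hd : s.depth ≤ d) (n : ℕ) :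
    CostBound R s n d := by
  rintro (_ | ℓ) t ht
  · obtain rfl : s = t := ht
    exact ⟨Nat.zero_le _, fun _ => hd⟩
  · obtain ⟨u, hu, -⟩ := ht
    exact absurd hu.rew (h u)

theorem CostBound.of_step {s : Term ar V} {n d : ℕ} (h : ∀ t, IRew R s t → CostBound R t n d)
    (hd : s.depth ≤ d) : CostBound R s (n + 1) d := by
  rintro (_ | ℓ) t ht
  · obtain rfl : s = t := ht
    exact ⟨Nat.zero_le _, fun _ => hd⟩
  · obtain ⟨u, hu, ht⟩ := ht
    obtain ⟨h1, h2⟩ := h u hu ℓ t ht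
    exact ⟨Nat.succ_le_succ h1, h2⟩

theorem CostBound.step {s t : Term ar V} {n d : ℕ} (h : CostBound R s n d) (hst : IRew R s t) :
    ∃ m, n = m + 1 ∧ CostBound R t m d := by
  have h1 : 1 ≤ n := (h 1 t ⟨t, hst, rfl⟩).1
  refine ⟨n - 1, by omega, fun ℓ u hu => ?_⟩
  obtain ⟨h2, h3⟩ := h (ℓ + 1) u ⟨t, hst, hu⟩
  exact ⟨by omega, h3⟩

/-- No root step occurs before all arguments are normal, so however the argument derivations
interleave, their lengths add up; each argument step lowers its own budget by one. -/
theorem CostBound.app {g : F} {m d : ℕ} {e : Fin (ar g) → ℕ} {ts : Fin (ar g) → Term ar V}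
    {a : Fin (ar g) → ℕ} (h : ∀ i, CostBound R (ts i) (a i) (e i))
    (hroot : ∀ us : Fin (ar g) → Term ar V, (∀ i, NF R (us i)) → (∀ i, (us i).depth ≤ e i) →
      CostBound R (.app g us) m d) :
    CostBound R (.app g ts) (∑ i, a i + m) d := by
  intro ℓ
  induction ℓ generalizing ts a with
  | zero =>
    intro t ht
    obtain rfl : Term.app g ts = t := ht
    refine ⟨Nat.zero_le _, fun hnf => ?_⟩
    exact (hroot ts hnf.arg (fun i => (h i 0 _ rfl).2 (hnf.arg i)) 0 _ rfl).2 hnf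
  | succ ℓ ih =>
    intro t ht
    obtain ⟨u, hu, hut⟩ := ht
    have hu' := hu
    generalize hs : Term.app g ts = s at hu
    cases hu with
    | root l r hlr σ hnf =>
      have hts := hnf g ts hs.symm
      -- The arguments are already normal, so `hroot` bounds the whole remaining derivation,
      -- including this root step.
      obtain ⟨h1, h2⟩ := hroot ts hts (fun i => (h i 0 _ rfl).2 (hts i)) (ℓ + 1) t ⟨_, hu', hut⟩
      exact ⟨h1.trans (Nat.le_add_left _ _), h2⟩
    | ctx f us i v hv =>
      cases hs
      obtain ⟨k, hk, hb⟩ := (h i).step hv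
      have key : ∀ j, CostBound R (Function.update ts i v j) (Function.update a i k j) (e j) := by
        intro j
        by_cases hj : j = i
        · subst hj
          simpa using hb
        · simpa [hj] using h j
      obtain ⟨h1, h2⟩ := ih key t hut
      refine ⟨?_, h2⟩
      have hsum := Finset.sum_update_of_mem (Finset.mem_univ i) a k
      have hsum' := Finset.add_sum_erase Finset.univ a (Finset.mem_univ i)
      rw [Finset.sdiff_singleton_eq_erase] at hsum
      omega

theorem CostBound.dheight_le {s : Term ar V} {n d : ℕ} (h : CostBound R s n d) :
    dheight R s ≤ n := by
  refine iSup₂_le fun ℓ ⟨t, ht⟩ => ?_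
  exact_mod_cast (h ℓ t ht).1

/-- Calls of `g` on normal forms have cost polynomial in the normal arguments, and their results
exceed the depth of the safe arguments by at most a polynomial in the normal arguments. -/
def CallBound (S : SafeMapping ar D) (R : Set (Term ar V × Term ar V)) (g : F)
    (p : Polynomial ℕ) : Prop :=
  ∀ us : Fin (ar g) → Term ar V, (∀ i, NF R (us i)) →
    CostBound R (.app g us) (p.eval (S.normalDepth g us))
      (p.eval (S.normalDepth g us) + S.safeDepth g us)

theorem CallBound.app {g : F} {p : Polynomial ℕ} (hp : CallBound S R g p)
    {ts : Fin (ar g) → Term ar V} {a e : Fin (ar g) → ℕ}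
    (h : ∀ i, CostBound R (ts i) (a i) (e i)) {n w : ℕ} (hn : ∀ i ∉ S.safe g, e i ≤ n)
    (hw : ∀ i ∈ S.safe g, e i ≤ w) :
    CostBound R (.app g ts) (∑ i, a i + p.eval n) (p.eval n + w) := by
  refine CostBound.app h fun us hus hd => (hp us hus).mono (eval_mono p ?_)
    (Nat.add_le_add (eval_mono p ?_) ?_)
  · exact Finset.sup_le fun i hi => (hd i).trans (hn i (Finset.mem_compl.1 hi))
  · exact Finset.sup_le fun i hi => (hd i).trans (hn i (Finset.mem_compl.1 hi))
  · exact Finset.sup_le fun i hi => (hd i).trans (hw i hi)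

/-! ### Cost of instantiated right-hand sides -/

/-- Terms below `f(ss)` in the auxiliary order are built from parts of normal arguments by symbols
below `f`, so safe arguments of `f` contribute neither to the cost nor to the depth, and polynomials
compose finitely often, following the derivation of `Gsq`. -/
theorem Gsq.exists_costBound (hR : IsConstructorTRS D R) (hP : Admissible D P) {f : F}
    {ss : Fin (ar f) → Term ar V} (hf : f ∈ D) (hss : ∀ i, IsValue D (ss i)) {p₀ : Polynomial ℕ}
    (hp₀ : ∀ g, PrecGt P f g → CallBound S R g p₀) {t : Term ar V}
    (h : Gsq S P (.app f ss) t) :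
    ∃ p : Polynomial ℕ, ∀ σ : V → Term ar V, (∀ x, NF R (σ x)) →
      CostBound R (t.subst σ) (p.eval (S.normalDepth f fun i => (ss i).subst σ))
        (p.eval (S.normalDepth f fun i => (ss i).subst σ)) := by
  generalize hs : Term.app f ss = s at h
  induction h with
  | st_equiv f' ss' t i hi h =>
    cases hs
    refine ⟨Polynomial.X, fun σ hσ => .of_nf (hR.nf_subst hσ (h.isValue hP (hss i))) ?_ _⟩
    rw [← h.depth_subst_eq σ, Polynomial.eval_X]
    exact S.depth_le_normalDepth (ts := fun i => (ss i).subst σ) (hi hf)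
  | st_gt f' ss' t i hi h _ =>
    cases hs
    obtain ⟨h1, h2⟩ := h.of_isValue hP (hss i)
    refine ⟨Polynomial.X, fun σ hσ => .of_nf (hR.nf_subst hσ h1) ?_ _⟩
    rw [Polynomial.eval_X]
    exact (h2 σ).le.trans (S.depth_le_normalDepth (ts := fun i => (ss i).subst σ) (hi hf))
  | ia f' g ss' ts _ hfg _ ih =>
    cases hs
    choose p hp using fun j => ih j rfl
    -- The summands pay for evaluating the arguments, for the call of `g`, and for the depth of its
    -- safe arguments.
    refine ⟨∑ j, p j + p₀.comp (∑ j, p j) + ∑ j, p j, fun σ hσ => ?_⟩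
    have h1 := (hp₀ g hfg).app (fun j => hp j σ hσ)
      (n := (∑ j, p j).eval (S.normalDepth f fun i => (ss i).subst σ))
      (w := (∑ j, p j).eval (S.normalDepth f fun i => (ss i).subst σ))
      (fun j _ => eval_le_eval_sum _ p _ (Finset.mem_univ j))
      (fun j _ => eval_le_eval_sum _ p _ (Finset.mem_univ j))
    refine h1.mono ?_ ?_ <;>
      simp only [Polynomial.eval_add, Polynomial.eval_comp, Polynomial.eval_finsetSum] <;> omega

/-- All calls of symbols equivalent to `f` whose normal arguments descend from the normal arguments
`ss` of `f` take at most `a` steps and increase the depth of the safe arguments by at most `b`. -/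
def RecursiveCallBound (S : SafeMapping ar D) (P : Preorder F) (R : Set (Term ar V × Term ar V))
    (f : F) (ss : Fin (ar f) → Term ar V) (a b : ℕ) : Prop :=
  ∀ (g : F) (us : Fin (ar g) → Term ar V), PrecEquiv P f g → (∀ i, NF R (us i)) →
    MulGt Eq (· > ·) ((S.normalArgs f ss).map Term.depth) ((S.normalArgs g us).map Term.depth) →
    S.safeDepth g us ≤ S.safeDepth f ss →
    CostBound R (.app g us) a (b + S.safeDepth f ss)

theorem SafeMapping.normalArgs_comp (S : SafeMapping ar D) (f : F) (ts : Fin (ar f) → Term ar V)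
    (φ : Term ar V → Term ar V) :
    S.normalArgs f (fun i => φ (ts i)) = (S.normalArgs f ts).map φ := by
  simp [SafeMapping.normalArgs, Multiset.map_map]

theorem SafeMapping.mem_normalArgs {f : F} {ts : Fin (ar f) → Term ar V} {t : Term ar V} :
    t ∈ S.normalArgs f ts ↔ ∃ i ∉ S.safe f, ts i = t := by
  simp [SafeMapping.normalArgs]

theorem SafeMapping.mem_safeArgs {f : F} {ts : Fin (ar f) → Term ar V} {t : Term ar V} :
    t ∈ S.safeArgs f ts ↔ ∃ i ∈ S.safe f, ts i = t := by
  simp [SafeMapping.safeArgs]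

/-- Everything dominated by a value is a value, so the arguments of the recursive call are normal
once instantiated and contain no nested calls to be evaluated. Depth sends safe equivalence to
equality and the order to `>`, turning descent of terms into descent of multisets of numbers. -/
theorem RecursiveCallBound.costBound (hR : IsConstructorTRS D R) (hP : Admissible D P) {f g : F}
    {ss : Fin (ar f) → Term ar V} {ts : Fin (ar g) → Term ar V} (hss : ∀ i, IsValue D (ss i))
    (hfg : PrecEquiv P f g)
    (hnormal : MulGt (SafeEquiv S P) (Gpop S P) (S.normalArgs f ss) (S.normalArgs g ts))
    (hsafe : MulGe (SafeEquiv S P) (Gpop S P) (S.safeArgs f ss) (S.safeArgs g ts))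
    {σ : V → Term ar V} (hσ : ∀ x, NF R (σ x)) {a b : ℕ}
    (h : RecursiveCallBound S P R f (fun i => (ss i).subst σ) a b) :
    CostBound R ((Term.app g ts).subst σ) a
      (b + S.safeDepth f fun i => (ss i).subst σ) := by
  have hle : ∀ s t, IsValue D s → SafeEquiv S P s t ∨ Gpop S P s t →
      IsValue D t ∧ (t.subst σ).depth ≤ (s.subst σ).depth := by
    rintro s t hs (h | h)
    · exact ⟨h.isValue hP hs, (h.depth_subst_eq σ).ge⟩
    · exact ⟨(h.of_isValue hP hs).1, ((h.of_isValue hP hs).2 σ).le⟩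
  have hsafe' : ∀ j ∈ S.safe g, IsValue D (ts j) ∧
      ((ts j).subst σ).depth ≤ S.safeDepth f fun i => (ss i).subst σ := by
    intro j hj
    obtain ⟨s, hs, hst⟩ := hsafe.exists_of_mem (SafeMapping.mem_safeArgs.2 ⟨j, hj, rfl⟩)
    obtain ⟨i, hi, rfl⟩ := SafeMapping.mem_safeArgs.1 hs
    obtain ⟨h1, h2⟩ := hle _ _ (hss i) hst
    exact ⟨h1, h2.trans (S.depth_le_safeDepth (ts := fun i => (ss i).subst σ) hi)⟩
  refine h g (fun j => (ts j).subst σ) hfg (fun j => hR.nf_subst hσ ?_) ?_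
    (Finset.sup_le fun j hj => (hsafe' j hj).2)
  · by_cases hj : j ∈ S.safe g
    · exact (hsafe' j hj).1
    · obtain ⟨s, hs, hst⟩ :=
        MulGe.exists_of_mem (.inl hnormal) (SafeMapping.mem_normalArgs.2 ⟨j, hj, rfl⟩)
      obtain ⟨i, -, rfl⟩ := SafeMapping.mem_normalArgs.1 hs
      exact (hle _ _ (hss i) hst).1
  · rw [S.normalArgs_comp f ss (Term.subst σ), S.normalArgs_comp g ts (Term.subst σ),
      Multiset.map_map, Multiset.map_map]
    refine hnormal.map (fun s _ t hst => hst.depth_subst_eq σ) fun s hs t hst => ?_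
    obtain ⟨i, -, rfl⟩ := SafeMapping.mem_normalArgs.1 hs
    exact (hst.of_isValue hP (hss i)).2 σ

/-- The polynomial is chosen before `σ`, `a` and `b`, and `a`, `b` occur with coefficient one; this
linearity is what lets recursion be unfolded without exponential growth. The recursive bound is
required only when `t` has a symbol not below `f`, so other arguments can be treated with `a = b =
0`. -/
theorem Gpop.exists_costBound (hR : IsConstructorTRS D R) (hP : Admissible D P) {f : F}
    {ss : Fin (ar f) → Term ar V} (hf : f ∈ D) (hss : ∀ i, IsValue D (ss i)) {p₀ : Polynomial ℕ}
    (hp₀ : ∀ g, PrecGt P f g → CallBound S R g p₀) {t : Term ar V}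
    (h : Gpop S P (.app f ss) t) :
    ∃ p : Polynomial ℕ, ∀ σ : V → Term ar V, (∀ x, NF R (σ x)) → ∀ a b : ℕ,
      (¬ TermsOver {h | PrecGt P f h} t →
        RecursiveCallBound S P R f (fun i => (ss i).subst σ) a b) →
      CostBound R (t.subst σ) (a + p.eval (S.normalDepth f fun i => (ss i).subst σ))
        (b + p.eval (S.normalDepth f fun i => (ss i).subst σ) +
          S.safeDepth f fun i => (ss i).subst σ) := by
  generalize hs : Term.app f ss = s at h
  induction h with
  | st_equiv f' ss' t i h =>
    cases hs
    refine ⟨Polynomial.X, fun σ hσ a b _ =>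
      .of_nf (hR.nf_subst hσ (h.isValue hP (hss i))) ?_ _⟩
    rw [← h.depth_subst_eq σ, Polynomial.eval_X]
    have := S.depth_arg_le f (fun i => (ss i).subst σ) i
    omega
  | st_gt f' ss' t i h _ =>
    cases hs
    obtain ⟨h1, h2⟩ := h.of_isValue hP (hss i)
    refine ⟨Polynomial.X, fun σ hσ a b _ => .of_nf (hR.nf_subst hσ h1) ?_ _⟩
    rw [Polynomial.eval_X]
    have := S.depth_arg_le f (fun i => (ss i).subst σ) i
    have := h2 σ
    omega
  | ia f' g ss' ts _ hfg hnormal _ hone ih =>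
    cases hs
    have key : ∀ j, ∃ p : Polynomial ℕ, ∀ σ : V → Term ar V, (∀ x, NF R (σ x)) →
        (j ∉ S.safe g →
          CostBound R ((ts j).subst σ) (p.eval (S.normalDepth f fun i => (ss i).subst σ))
            (p.eval (S.normalDepth f fun i => (ss i).subst σ))) ∧
        (j ∈ S.safe g → ∀ a b : ℕ, (¬ TermsOver {h | PrecGt P f h} (ts j) →
            RecursiveCallBound S P R f (fun i => (ss i).subst σ) a b) →
          CostBound R ((ts j).subst σ) (a + p.eval (S.normalDepth f fun i => (ss i).subst σ))
            (b + p.eval (S.normalDepth f fun i => (ss i).subst σ) +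
              S.safeDepth f fun i => (ss i).subst σ)) := by
      intro j
      by_cases hj : j ∈ S.safe g
      · obtain ⟨p, hp⟩ := ih j hj rfl
        exact ⟨p, fun σ hσ => ⟨fun h => absurd hj h, fun _ => hp σ hσ⟩⟩
      · obtain ⟨p, hp⟩ := (hnormal j hj).exists_costBound hR hP hf hss hp₀
        exact ⟨p, fun σ hσ => ⟨fun _ => hp σ hσ, fun h => absurd h hj⟩⟩
    choose p hp using key
    refine ⟨∑ j, p j + p₀.comp (∑ j, p j), fun σ hσ a b hab => ?_⟩
    set d := S.normalDepth f fun i => (ss i).subst σ with hd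
    set w := S.safeDepth f fun i => (ss i).subst σ with hw
    have hple : ∀ j, (p j).eval d ≤ (∑ j, p j).eval d := fun j =>
      eval_le_eval_sum _ p _ (Finset.mem_univ j)
    classical
    let isRec : Fin (ar g) → Prop := fun j =>
      j ∈ S.safe g ∧ ¬ TermsOver {h | PrecGt P f h} (ts j)
    have hargs : ∀ j, CostBound R ((ts j).subst σ) ((if isRec j then a else 0) + (p j).eval d)
        (if j ∈ S.safe g then b + (∑ j, p j).eval d + w else (∑ j, p j).eval d) := by
      intro j
      by_cases hj : j ∈ S.safe g
      · by_cases hjt : TermsOver {h | PrecGt P f h} (ts j)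
        -- Only symbols below `f` occur here, so the recursive hypothesis is vacuous and nothing is
        -- charged for recursion.
        · refine ((hp j σ hσ).2 hj 0 0 fun h => absurd hjt h).mono ?_ ?_
          · simp [isRec, hjt, hd]
          · have := hple j
            simp only [hj, if_true, ← hd, ← hw]
            omega
        · have hnot : ¬ TermsOver {h | PrecGt P f h} (Term.app g ts) := by
            intro h
            generalize hs : Term.app g ts = s at h
            cases h with
            | var x => cases hs
            | app g' us _ hus =>
              cases hs
              exact hjt (hus j)
          refine ((hp j σ hσ).2 hj a b fun _ => hab hnot).mono ?_ ?_
          · simp [isRec, hj, hjt, hd]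
          · have := hple j
            simp only [hj, if_true, ← hd, ← hw]
            omega
      · refine ((hp j σ hσ).1 hj).mono (Nat.le_add_left _ _) ?_
        simpa [hj] using hple j
    -- Here the restriction to one recursive safe argument is used: `a` is paid at most once.
    have hsum : ∑ j, (if isRec j then a else 0) ≤ a := by
      by_cases hex : ∃ j, isRec j
      · obtain ⟨j₀, h0⟩ := hex
        rw [Finset.sum_eq_single j₀ (fun j _ hj => if_neg fun h =>
          hj (hone j j₀ h.1 h0.1 h.2 h0.2)) (by simp), if_pos h0]
      · simp only [not_exists] at hex
        simp [hex]
    refine ((hp₀ g hfg).app hargs (n := (∑ j, p j).eval d)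
      (w := b + (∑ j, p j).eval d + w) (fun j hj => by simp [hj])
      (fun j hj => by simp [hj])).mono ?_ ?_
    · rw [Finset.sum_add_distrib, Polynomial.eval_add, Polynomial.eval_comp,
        Polynomial.eval_finsetSum]
      omega
    · rw [Polynomial.eval_add, Polynomial.eval_comp]
      omega
  | ep f' g ss' ts _ hfg gt hgt hnormal hsafe _ =>
    cases hs
    refine ⟨0, fun σ hσ a b hab => ?_⟩
    have hnot : ¬ TermsOver {h | PrecGt P f h} (Term.app g ts) := by
      intro h
      generalize hs : Term.app g ts = s at h
      cases h with
      | var x => cases hs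
      | app g' us hg _ =>
        cases hs
        exact hg.2 hfg.2
    simpa using (hab hnot).costBound hR hP hss hfg (hnormal.mono hgt) (hsafe.mono hgt) hσ

/-! ### Induction along the precedence -/

theorem SafeMapping.normalDepth_eq (S : SafeMapping ar D) (f : F) (ts : Fin (ar f) → Term ar V) :
    S.normalDepth f ts = ((S.normalArgs f ts).map Term.depth).sup := by
  rw [SafeMapping.normalArgs, Multiset.map_map]
  exact Finset.sup_def

theorem CostBound.of_rules (hR : IsConstructorTRS D R) {g : F} {us : Fin (ar g) → Term ar V}
    (hus : ∀ i, NF R (us i)) {n d : ℕ}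
    (h : ∀ ss, (∀ i, IsValue D (ss i)) → ∀ r, (Term.app g ss, r) ∈ R → g ∈ D →
      ∀ σ : V → Term ar V, (∀ x, NF R (σ x)) → (us = fun i => (ss i).subst σ) →
        CostBound R (r.subst σ) n d)
    (hd : (Term.app g us).depth ≤ d) : CostBound R (.app g us) (n + 1) d := by
  refine .of_step (fun t ht => ?_) hd
  generalize hs : Term.app g us = s at ht
  cases ht with
  | root l r hlr σ _ =>
    obtain ⟨f, hf, ss, rfl, hss⟩ := hR.exists_eq_app hlr
    classical
    -- Only variables of the left-hand side are known to be mapped to normal forms; resetting the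
    -- others to themselves makes the substitution normal everywhere without changing either side of
    -- the rule.
    let τ : V → Term ar V := fun x => if x ∈ (Term.app f ss).vars then σ x else .var x
    have hl : (Term.app f ss).subst σ = (Term.app f ss).subst τ :=
      Term.subst_congr fun x hx => (if_pos hx).symm
    have hr : r.subst σ = r.subst τ :=
      Term.subst_congr fun x hx => (if_pos ((hR.1 _ _ hlr).2 hx)).symm
    rw [hr]
    rw [hl] at hs
    simp only [Term.subst] at hs
    cases hs
    refine h ss hss r hlr hf τ (fun x => ?_) rfl
    by_cases hx : x ∈ (Term.app g ss).vars
    · obtain ⟨i, hi⟩ := Set.mem_iUnion.1 hx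
      exact (hus i).of_mem_vars hi
    · simp only [τ, if_neg hx]
      exact hR.nf_var x
  | ctx f vs i v hv =>
    cases hs
    exact absurd hv.rew (hus i v)

theorem exists_callBound [Finite F] (hR : IsConstructorTRS D R) (hfin : R.Finite)
    (hP : Admissible D P) (hc : Compatible S P R) (f : F) :
    ∃ p : Polynomial ℕ, CallBound S R f p := by
  have := Fintype.ofFinite F
  have wf : WellFounded fun g f : F => PrecGt P f g := by
    have : IsTrans F fun g f : F => PrecGt P f g :=
      ⟨fun a b c hab hbc => ⟨P.le_trans _ _ _ hab.1 hbc.1,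
        fun h => hab.2 (P.le_trans _ _ _ hbc.1 h)⟩⟩
    have : Std.Irrefl fun g f : F => PrecGt P f g := ⟨fun a h => h.2 h.1⟩
    exact Finite.wellFounded_of_trans_of_irrefl _
  induction f using wf.induction with
  | _ f ih =>
  choose! q hq using ih
  have hle : ∀ g, PrecGt P f g → CallBound S R g (∑ g, q g) := fun g hg us hus =>
    (hq g hg us hus).mono (eval_le_eval_sum _ q _ (Finset.mem_univ g))
      (Nat.add_le_add_right (eval_le_eval_sum _ q _ (Finset.mem_univ g)) _)
  -- Recursion may move between equivalent symbols, so the rules of the whole class of `f` are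
  -- treated together. Pairs that are not such rules get the polynomial `0`.
  have hrule : ∀ lr : Term ar V × Term ar V, ∃ p : Polynomial ℕ, lr ∈ R → ∀ (g : F)
      (ss : Fin (ar g) → Term ar V), lr.1 = .app g ss → PrecEquiv P f g → g ∈ D →
      (∀ i, IsValue D (ss i)) → ∀ σ : V → Term ar V, (∀ x, NF R (σ x)) → ∀ a b : ℕ,
      RecursiveCallBound S P R g (fun i => (ss i).subst σ) a b →
      CostBound R (lr.2.subst σ) (a + p.eval (S.normalDepth g fun i => (ss i).subst σ))
        (b + p.eval (S.normalDepth g fun i => (ss i).subst σ) +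
          S.safeDepth g fun i => (ss i).subst σ) := by
    rintro ⟨l, r⟩
    by_cases hex : ∃ (g : F) (ss : Fin (ar g) → Term ar V), (Term.app g ss, r) ∈ R ∧
        l = .app g ss ∧ PrecEquiv P f g ∧ g ∈ D ∧ ∀ i, IsValue D (ss i)
    · obtain ⟨g, ss, hlr, rfl, hfg, hg, hss⟩ := hex
      obtain ⟨p, hp⟩ := (hc _ _ hlr).exists_costBound hR hP hg hss (p₀ := ∑ g, q g)
        fun h hgh => hle h ⟨P.le_trans _ _ _ hgh.1 hfg.1,
          fun h' => hgh.2 (P.le_trans _ _ _ hfg.1 h')⟩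
      refine ⟨p, fun _ g' ss' hs _ _ _ σ hσ a b hab => ?_⟩
      cases hs
      exact hp σ hσ a b fun _ => hab
    · refine ⟨0, fun hlr g ss hs hfg hg hss => absurd ⟨g, ss, ?_, hs, hfg, hg, hss⟩ hex⟩
      simpa [← hs] using hlr
  choose q' hq' using hrule
  set p := ∑ lr ∈ hfin.toFinset, q' lr with hp
  -- One digit count that suffices for the normal arguments of every symbol in the class.
  set k := ∑ g, ar g with hk
  -- The depth bound `d` stays fixed along the recursion, while `n` exceeds the rank. Each unfolding
  -- adds `p(d) + 1` steps and `p(d)` depth; the single `1 + d` covers the case in which the call is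
  -- itself a normal form.
  have main : ∀ d n : ℕ, ∀ (g : F) (us : Fin (ar g) → Term ar V), PrecEquiv P f g →
      (∀ i, NF R (us i)) → S.normalDepth g us ≤ d →
      multisetRank (d + 1) k ((S.normalArgs g us).map Term.depth) < n →
      CostBound R (.app g us) (n * (p.eval d + 1))
        (n * p.eval d + (1 + d) + S.safeDepth g us) := by
    intro d n
    induction n with
    | zero => intro g us _ _ _ h; exact absurd h (Nat.not_lt_zero _)
    | succ n ihn =>
      intro g us hfg hus hd hrank
      have hstep : CostBound R (.app g us) (n * (p.eval d + 1) + p.eval d + 1)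
          (n * p.eval d + (1 + d) + p.eval d + S.safeDepth g us) := by
        refine .of_rules hR hus (fun ss hss r hlr hg σ hσ hus' => ?_) ?_
        · subst hus'
          have hrec : RecursiveCallBound S P R g (fun i => (ss i).subst σ) (n * (p.eval d + 1))
              (n * p.eval d + (1 + d)) := by
            intro g' us' hgg' hus' hmul hsafe
            refine (ihn g' us' ⟨P.le_trans _ _ _ hgg'.1 hfg.1, P.le_trans _ _ _ hfg.2 hgg'.2⟩
              hus' ?_ ?_).mono le_rfl (Nat.add_le_add_left hsafe _)
            · rw [S.normalDepth_eq]
              refine Multiset.sup_le.2 fun m hm => ?_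
              obtain ⟨m', hm', hle⟩ := hmul.exists_le hm
              refine hle.trans ((Multiset.le_sup hm').trans ?_)
              rwa [← S.normalDepth_eq]
            · refine (multisetRank_lt_of_mulGt k _ _ (fun m hm => ⟨?_, ?_⟩) ?_ hmul).trans_le
                (Nat.le_of_lt_succ hrank)
              · obtain ⟨t, -, rfl⟩ := Multiset.mem_map.1 hm
                exact t.depth_pos
              · refine Nat.lt_succ_of_le ((Multiset.le_sup hm).trans ?_)
                rwa [← S.normalDepth_eq]
              · rw [Multiset.card_map, SafeMapping.normalArgs, Multiset.card_map]
                refine (Finset.card_le_univ _).trans ?_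
                rw [Fintype.card_fin]
                exact Finset.single_le_sum (f := ar) (fun _ _ => Nat.zero_le _)
                  (Finset.mem_univ g)
          have hpd : (q' (Term.app g ss, r)).eval (S.normalDepth g fun i => (ss i).subst σ) ≤
              p.eval d :=
            (eval_mono _ hd).trans (eval_le_eval_sum _ q' _ (hfin.mem_toFinset.2 hlr))
          refine (hq' _ hlr g ss rfl hfg hg hss σ hσ _ _ hrec).mono ?_ ?_
          · exact Nat.add_le_add_left hpd _
          · exact Nat.add_le_add_right (Nat.add_le_add_left hpd _) _
        · have := S.depth_app_le g us
          omega
      refine hstep.mono (le_of_eq (by ring)) (le_of_eq (by ring))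
  -- This is `main` at `n = (d + 1) ^ k`, which exceeds every rank to base `d + 1` with `k` digits.
  refine ⟨(Polynomial.X + 1) ^ k * (p + 1) + (1 + Polynomial.X), fun us hus => ?_⟩
  refine (main _ _ f us ⟨P.le_refl f, P.le_refl f⟩ hus le_rfl
    (multisetRank_lt (Nat.succ_pos _) k _ fun m hm => ?_)).mono ?_ ?_
  · refine Nat.lt_succ_of_le ((Multiset.le_sup hm).trans ?_)
    rw [← S.normalDepth_eq]
  · simp
  · simp only [Polynomial.eval_add, Polynomial.eval_mul, Polynomial.eval_pow, Polynomial.eval_X,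
      Polynomial.eval_one]
    gcongr
    · exact le_rfl
    · exact Nat.le_succ _

/-! ### Uniformity in the safe mapping and the precedence -/

instance [Finite F] : Finite (SafeMapping ar D) :=
  Finite.of_injective SafeMapping.safe fun S S' h => by
    cases S
    cases S'
    simpa using h

instance [Finite F] : Finite (Preorder F) :=
  Finite.of_injective (fun P : Preorder F => P.le) fun _ _ h =>
    Preorder.ext fun x y => iff_of_eq (congrFun (congrFun h x) y)

theorem exists_dheight_le [Finite F] (hR : IsConstructorTRS D R) (hfin : R.Finite) :
    ∃ p : Polynomial ℕ, ∀ (S : SafeMapping ar D) (P : Preorder F), Admissible D P →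
      Compatible S P R → ∀ (f : F) (ts : Fin (ar f) → Term ar V), (∀ i, IsValue D (ts i)) →
        dheight R (.app f ts) ≤ ((p.eval (S.normalDepth f ts) : ℕ) : ℕ∞) := by
  have := Fintype.ofFinite (SafeMapping ar D × Preorder F × F)
  have h : ∀ x : SafeMapping ar D × Preorder F × F, ∃ p : Polynomial ℕ, Admissible D x.2.1 →
      Compatible x.1 x.2.1 R → CallBound x.1 R x.2.2 p := by
    rintro ⟨S, P, f⟩
    by_cases hc : Admissible D P ∧ Compatible S P R
    · obtain ⟨p, hp⟩ := exists_callBound hR hfin hc.1 hc.2 f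
      exact ⟨p, fun _ _ => hp⟩
    · exact ⟨0, fun h1 h2 => absurd ⟨h1, h2⟩ hc⟩
  choose p hp using h
  refine ⟨∑ x, p x, fun S P hP hc f ts hts => ?_⟩
  refine (hp (S, P, f) hP hc ts fun i => (hts i).nf hR).dheight_le.trans ?_
  exact_mod_cast eval_le_eval_sum _ p _ (Finset.mem_univ (S, P, f))

theorem SafeMapping.normalDepth_le_size (S : SafeMapping ar D) (f : F)
    (ts : Fin (ar f) → Term ar V) : S.normalDepth f ts ≤ (Term.app f ts).size :=
  Finset.sup_le fun i _ => (Term.depth_arg_lt f ts i).le.trans (Term.depth_le_size _)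

end

end POP

theorem theorem1 {F V : Type*} [Finite F] [Countable V] [Infinite V] (ar : F → ℕ) (D : Set F)
    (R : Set (POP.Term ar V × POP.Term ar V)) (hfin : R.Finite)
    (hR : POP.PredicativeRecursive D R) :
    (∃ p : Polynomial ℕ, ∀ (S : POP.SafeMapping ar D) (P : Preorder F),
      POP.Admissible D P → POP.Compatible S P R →
        ∀ f ∈ D, ∀ ts : Fin (ar f) → POP.Term ar V, (∀ i, POP.IsValue D (ts i)) →
          POP.dheight R (.app f ts) ≤ ((p.eval (S.normalDepth f ts) : ℕ) : ℕ∞)) ∧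
    (∃ q : Polynomial ℕ, ∀ n : ℕ, POP.runtimeComplexity D R n ≤ ((q.eval n : ℕ) : ℕ∞)) := by
  obtain ⟨hR', S, P, hP, hc⟩ := hR
  obtain ⟨p, hp⟩ := POP.exists_dheight_le hR' hfin
  refine ⟨⟨p, fun S P hP hc f _ ts hts => hp S P hP hc f ts hts⟩, p, fun n => ?_⟩
  refine iSup₂_le fun s hs => ?_
  rcases hs with ⟨⟨x, rfl⟩ | ⟨f, _, ts, rfl, hts⟩, hsize⟩
  · refine (POP.CostBound.of_nf (hR'.nf_var x) le_rfl 0).dheight_le.trans ?_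
    simp
  · refine (hp S P hP hc f ts hts).trans ?_
    exact_mod_cast POP.eval_mono p ((S.normalDepth_le_size f ts).trans hsize)
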